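/- Let $n\ge 0$ be an integer, let $P_1\in\mathbb C^{n\times n}$ be Hermitian and invertible, let $P_0\in\mathbb C^{n\times n}$ and $\tilde W_B\in\mathbb C^{n\times 2n}$, and let $\mathcal H:(0,1)\to\mathbb C^{n\times n}$ be such that $\mathcal H(\zeta)$ is a positive definite Hermitian matrix for a.e. $\zeta\in(0,1)$ and $\mathcal H,\mathcal H^{-1}\in L^\infty(0,1;\mathbb C^{n\times n})$. Let $X_2=L^2(0,1;\mathbb C^n)$ and let $A$ be the operator $$Ax=P_1\frac{dx}{d\zeta}+P_0x,\qquad D(A)=\Big\{x\in W^{1,2}(0,1;\mathbb C^n)\;\Big|\;\tilde W_B\begin{bmatrix}x(1)\\x(0)\end{bmatrix}=0\Big\}$$ on $X_2$, where $x(1),x(0)$ are the values of the continuous representative of $x$ on $[0,1]$. Let $A\mathcal H$ be the operator $x\mapsto A(\mathcal Hx)$ with domain $D(A\mathcal H)=\{x\in X_2\mid \mathcal Hx\in D(A)\}$, regarded as an operator on the energy space $(X_2,\langle\cdot,\mathcal H\cdot\rangle)$, that is, $X_2$ with the inner product $\langle x,\mathcal Hy\rangle_{L^2}$ and the norm induced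 by it. An operator $\mathcal A$ generates a contraction semigroup if it is the infinitesimal generator of a $C_0$-semigroup $(T(t))_{t\ge0}$ with $\|T(t)\|\le1$ for all $t\ge0$; it generates a quasi-contractive semigroup if $\mathcal A-\omega I$ generates a contraction semigroup for some $\omega\in\mathbb R$. If $\operatorname{Re}P_0:=\tfrac12(P_0+P_0^*)\le 0$ (negative semidefinite), then $A\mathcal H$ generates a quasi-contractive semigroup on $(X_2,\langle\cdot,\mathcal H\cdot\rangle)$ if and only if $A\mathcal H$ generates a contraction semigroup on $(X_2,\langle\cdot,\mathcal H\cdot\rangle)$. -/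

import Mathlib

open Filter Topology MeasureTheory
open scoped ComplexOrder ContDiff

noncomputable section

namespace PortHamiltonian

/-! ### Strongly continuous semigroups and their generators -/

section Semigroup

variable {E : Type*} [NormedAddCommGroup E] [NormedSpace ℂ E]

/-- `(T t)_{t ≥ 0}` is a strongly continuous semigroup of bounded linear operators on `E`
(the values `T t` for `t < 0` play no role). -/
structure IsC0Semigroup (T : ℝ → E →L[ℂ] E) : Prop where
  map_zero : T 0 = ContinuousLinearMap.id ℂ E
  map_add : ∀ s t : ℝ, 0 ≤ s → 0 ≤ t → T (s + t) = (T s).comp (T t)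
  tendsto_zero : ∀ x : E, Tendsto (fun t : ℝ => T t x) (𝓝[>] 0) (𝓝 x)

/-- The (possibly unbounded) operator `G` is the infinitesimal generator of `T`: its domain is
exactly the set of `x` for which `lim_{t ↓ 0} t⁻¹ (T t x - x)` exists, and `G x` is that limit. -/
def IsGenerator (T : ℝ → E →L[ℂ] E) (G : E →ₗ.[ℂ] E) : Prop :=
  ∀ x y : E, (x, y) ∈ G.graph ↔
    Tendsto (fun t : ℝ => ((t⁻¹ : ℝ) : ℂ) • (T t x - x)) (𝓝[>] 0) (𝓝 y)

/-- `G` generates a contraction semigroup on `E`. -/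
def GeneratesContractionSemigroup (G : E →ₗ.[ℂ] E) : Prop :=
  ∃ T : ℝ → E →L[ℂ] E, IsC0Semigroup T ∧ (∀ t : ℝ, 0 ≤ t → ‖T t‖ ≤ 1) ∧ IsGenerator T G

/-- The operator `G - w I`, with the same domain as `G`. -/
def subScalar (G : E →ₗ.[ℂ] E) (w : ℝ) : E →ₗ.[ℂ] E :=
  (-((w : ℂ) • (LinearMap.id : E →ₗ[ℂ] E))) +ᵥ G

/-- `G` generates a quasi-contractive semigroup on `E`: `G - w I` generates a contraction semigroup
for some real `w`. -/
def GeneratesQuasiContractiveSemigroup (G : E →ₗ.[ℂ] E) : Prop :=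
  ∃ w : ℝ, GeneratesContractionSemigroup (subScalar G w)

end Semigroup

/-! ### The spaces `L²(0,1; ℂⁿ)` and `W^{1,2}(0,1; ℂⁿ)` -/

/-- Lebesgue measure on the interval `(0,1)`. -/
abbrev unitMeasure : Measure ℝ := volume.restrict (Set.Ioo 0 1)

/-- The state space `X₂ = L²(0,1; ℂⁿ)`. -/
abbrev X2 (n : ℕ) : Type := Lp (EuclideanSpace ℂ (Fin n)) 2 unitMeasure

/-- `z` is the weak derivative of `x` on `(0,1)`. -/
def HasWeakDeriv {n : ℕ} (x z : X2 n) : Prop :=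
  ∀ φ : ℝ → ℝ, ContDiff ℝ ∞ φ → HasCompactSupport φ → tsupport φ ⊆ Set.Ioo 0 1 →
    ∫ ζ, deriv φ ζ • x ζ ∂unitMeasure = -∫ ζ, φ ζ • z ζ ∂unitMeasure

/-- `f` is a representative of `x` that is continuous on the closed interval `[0,1]`; its values
`f 1` and `f 0` are the boundary values of `x`. -/
def IsContinuousRep {n : ℕ} (x : X2 n) (f : ℝ → EuclideanSpace ℂ (Fin n)) : Prop :=
  ContinuousOn f (Set.Icc 0 1) ∧ x =ᵐ[unitMeasure] f

lemma integrable_smul {n : ℕ} (x : X2 n) {φ : ℝ → ℝ} (hφ : Continuous φ)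
    (hc : HasCompactSupport φ) : Integrable (fun ζ => φ ζ • x ζ) unitMeasure := by
  obtain ⟨C, hC⟩ := hφ.bounded_above_of_compact_support hc
  exact ((Lp.memLp x).integrable (by norm_num)).bdd_smul C hφ.aestronglyMeasurable
    (Eventually.of_forall hC)

lemma HasWeakDeriv.add {n : ℕ} {x y z w : X2 n} (hx : HasWeakDeriv x z) (hy : HasWeakDeriv y w) :
    HasWeakDeriv (x + y) (z + w) := by
  intro φ h1 h2 h3
  have hd : Continuous (deriv φ) := h1.continuous_deriv (by simp)
  have e1 : ∫ ζ, deriv φ ζ • (x + y : X2 n) ζ ∂unitMeasure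
      = ∫ ζ, (deriv φ ζ • x ζ + deriv φ ζ • y ζ) ∂unitMeasure := by
    apply integral_congr_ae
    filter_upwards [Lp.coeFn_add x y] with ζ h
    rw [h, Pi.add_apply, smul_add]
  have e2 : ∫ ζ, φ ζ • (z + w : X2 n) ζ ∂unitMeasure
      = ∫ ζ, (φ ζ • z ζ + φ ζ • w ζ) ∂unitMeasure := by
    apply integral_congr_ae
    filter_upwards [Lp.coeFn_add z w] with ζ h
    rw [h, Pi.add_apply, smul_add]
  rw [e1, e2, integral_add (integrable_smul x hd h2.deriv) (integrable_smul y hd h2.deriv),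
    integral_add (integrable_smul z h1.continuous h2) (integrable_smul w h1.continuous h2),
    hx φ h1 h2 h3, hy φ h1 h2 h3, neg_add]

lemma HasWeakDeriv.smul {n : ℕ} {x z : X2 n} (c : ℂ) (hx : HasWeakDeriv x z) :
    HasWeakDeriv (c • x) (c • z) := by
  intro φ h1 h2 h3
  have e1 : ∫ ζ, deriv φ ζ • (c • x : X2 n) ζ ∂unitMeasure
      = ∫ ζ, c • (deriv φ ζ • x ζ) ∂unitMeasure := by
    apply integral_congr_ae
    filter_upwards [Lp.coeFn_smul c x] with ζ h
    rw [h, Pi.smul_apply, smul_comm]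
  have e2 : ∫ ζ, φ ζ • (c • z : X2 n) ζ ∂unitMeasure = ∫ ζ, c • (φ ζ • z ζ) ∂unitMeasure := by
    apply integral_congr_ae
    filter_upwards [Lp.coeFn_smul c z] with ζ h
    rw [h, Pi.smul_apply, smul_comm]
  rw [e1, e2, integral_smul, integral_smul, hx φ h1 h2 h3, smul_neg]

lemma HasWeakDeriv.unique {n : ℕ} {x z w : X2 n} (hz : HasWeakDeriv x z) (hw : HasWeakDeriv x w) :
    z = w := by
  have hi : Integrable (fun ζ => z ζ - w ζ) unitMeasure :=
    ((Lp.memLp z).integrable (by norm_num)).sub ((Lp.memLp w).integrable (by norm_num))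
  have key := isOpen_Ioo.ae_eq_zero_of_integral_contDiff_smul_eq_zero
    (U := Set.Ioo (0 : ℝ) 1) (hi.integrableOn.locallyIntegrableOn) (by
      intro g h1 h2 h3
      simp_rw [smul_sub]
      rw [integral_sub (integrable_smul z h1.continuous h2) (integrable_smul w h1.continuous h2),
        sub_eq_zero]
      exact neg_injective ((hz g h1 h2 h3).symm.trans (hw g h1 h2 h3)))
  apply Lp.ext
  filter_upwards [key, ae_restrict_mem measurableSet_Ioo] with ζ h hm
  exact sub_eq_zero.mp (h hm)

/-! ### The operator `A` -/

section OperatorA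

variable {n : ℕ}

/-- The domain of `A`: all `x ∈ W^{1,2}(0,1; ℂⁿ)` with `W [x(1); x(0)] = 0`, where the first `n`
columns of `W` act on `x(1)` and the last `n` columns on `x(0)`. -/
def domainA (W : Matrix (Fin n) (Fin n ⊕ Fin n) ℂ) : Submodule ℂ (X2 n) where
  carrier := {x | (∃ z, HasWeakDeriv x z) ∧
    ∃ f, IsContinuousRep x f ∧ W.mulVec (Sum.elim (f 1) (f 0)) = 0}
  add_mem' := by
    rintro x y ⟨⟨z, hz⟩, f, ⟨hf, hxf⟩, hW⟩ ⟨⟨w, hw⟩, g, ⟨hg, hyg⟩, hW'⟩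
    refine ⟨⟨z + w, hz.add hw⟩, f + g, ⟨hf.add hg, ?_⟩, ?_⟩
    · exact (Lp.coeFn_add x y).trans (hxf.add hyg)
    · have : (Sum.elim ((f + g) 1) ((f + g) 0) : Fin n ⊕ Fin n → ℂ)
          = Sum.elim (f 1) (f 0) + Sum.elim (g 1) (g 0) := by
        ext i; rcases i with i | i <;> simp
      rw [this, Matrix.mulVec_add, hW, hW', add_zero]
  zero_mem' := by
    refine ⟨⟨0, ?_⟩, 0, ⟨continuousOn_const, Lp.coeFn_zero _ _ _⟩, ?_⟩
    · have h0 : ∀ ψ : ℝ → ℝ, ∫ ζ, ψ ζ • (0 : X2 n) ζ ∂unitMeasure = 0 := by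
        intro ψ
        rw [integral_congr_ae (g := fun _ => 0), integral_zero]
        filter_upwards [Lp.coeFn_zero (EuclideanSpace ℂ (Fin n)) 2 unitMeasure] with ζ h
        rw [h, Pi.zero_apply, smul_zero]
      intro φ _ _ _
      rw [h0, h0, neg_zero]
    · have : (Sum.elim ((0 : ℝ → EuclideanSpace ℂ (Fin n)) 1)
          ((0 : ℝ → EuclideanSpace ℂ (Fin n)) 0) : Fin n ⊕ Fin n → ℂ) = 0 := by
        ext i; rcases i with i | i <;> simp
      rw [this, Matrix.mulVec_zero]
  smul_mem' := by
    rintro c x ⟨⟨z, hz⟩, f, ⟨hf, hxf⟩, hW⟩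
    refine ⟨⟨c • z, hz.smul c⟩, c • f, ⟨hf.const_smul c, ?_⟩, ?_⟩
    · exact (Lp.coeFn_smul c x).trans (hxf.const_smul c)
    · have : (Sum.elim ((c • f) 1) ((c • f) 0) : Fin n ⊕ Fin n → ℂ)
          = c • Sum.elim (f 1) (f 0) := by
        ext i; rcases i with i | i <;> simp
      rw [this, Matrix.mulVec_smul, hW, smul_zero]

/-- The weak derivative as a linear map on the domain of `A`. -/
def derivA (W : Matrix (Fin n) (Fin n ⊕ Fin n) ℂ) : domainA W →ₗ[ℂ] X2 n where
  toFun x := x.2.1.choose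
  map_add' x y :=
    (x + y).2.1.choose_spec.unique (x.2.1.choose_spec.add y.2.1.choose_spec)
  map_smul' c x := (c • x).2.1.choose_spec.unique (x.2.1.choose_spec.smul c)

lemma derivA_spec (W : Matrix (Fin n) (Fin n ⊕ Fin n) ℂ) (x : domainA W) :
    HasWeakDeriv (x : X2 n) (derivA W x) := x.2.1.choose_spec

/-- Pointwise multiplication by the constant matrix `P` on `L²(0,1; ℂⁿ)`. -/
def constMul (P : Matrix (Fin n) (Fin n) ℂ) : X2 n →ₗ[ℂ] X2 n :=
  ((Matrix.toEuclideanCLM (𝕜 := ℂ) P).compLpL 2 unitMeasure : X2 n →L[ℂ] X2 n)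

/-- The operator `A = P₁ d/dζ + P₀` on `L²(0,1; ℂⁿ)` with boundary condition given by `W`. -/
def opA (P₁ P₀ : Matrix (Fin n) (Fin n) ℂ) (W : Matrix (Fin n) (Fin n ⊕ Fin n) ℂ) :
    X2 n →ₗ.[ℂ] X2 n where
  domain := domainA W
  toFun := (constMul P₁).comp (derivA W) + (constMul P₀).comp (domainA W).subtype

end OperatorA

/-! ### The Hamiltonian density, the energy space, and the operator `A𝓗` -/

/-- A Hamiltonian density: a function `𝓗 : (0,1) → ℂ^{n×n}` with `𝓗, 𝓗⁻¹ ∈ L^∞(0,1; ℂ^{n×n})` whose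
values are a.e. positive (definite) Hermitian matrices. -/
structure HamiltonianDensity (n : ℕ) where
  toFun : ℝ → Matrix (Fin n) (Fin n) ℂ
  posDef : ∀ᵐ ζ ∂unitMeasure, (toFun ζ).PosDef
  memLp : ∀ i j, MemLp (fun ζ => toFun ζ i j) ⊤ unitMeasure
  memLp_inv : ∀ i j, MemLp (fun ζ => (toFun ζ)⁻¹ i j) ⊤ unitMeasure

namespace HamiltonianDensity

variable {n : ℕ} (H : HamiltonianDensity n)

lemma memLp_mulVec (x : X2 n) :
    MemLp (fun ζ => Matrix.toEuclideanCLM (𝕜 := ℂ) (H.toFun ζ) (x ζ)) 2 unitMeasure := by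
  rw [memLp_piLp_iff]
  intro i
  have : (fun ζ => (Matrix.toEuclideanCLM (𝕜 := ℂ) (H.toFun ζ) (x ζ)) i)
      = fun ζ => ∑ j, H.toFun ζ i j * x ζ j := by
    ext ζ
    simp [Matrix.ofLp_toEuclideanCLM, Matrix.mulVec, dotProduct]
  rw [this]
  refine memLp_finsetSum _ fun j _ => ?_
  exact ((Lp.memLp x).eval_piLp j).smul (r := 2) (H.memLp i j)

/-- The multiplication operator `x ↦ 𝓗 x` on `L²(0,1; ℂⁿ)`. -/
def mul : X2 n →ₗ[ℂ] X2 n where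
  toFun x := (H.memLp_mulVec x).toLp _
  map_add' x y := by
    apply Lp.ext
    filter_upwards [(H.memLp_mulVec (x + y)).coeFn_toLp, (H.memLp_mulVec x).coeFn_toLp,
      (H.memLp_mulVec y).coeFn_toLp, Lp.coeFn_add x y,
      Lp.coeFn_add ((H.memLp_mulVec x).toLp _) ((H.memLp_mulVec y).toLp _)] with ζ h1 h2 h3 h4 h5
    rw [h1, h5, Pi.add_apply, h2, h3, h4, Pi.add_apply, map_add]
  map_smul' c x := by
    apply Lp.ext
    filter_upwards [(H.memLp_mulVec (c • x)).coeFn_toLp, (H.memLp_mulVec x).coeFn_toLp,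
      Lp.coeFn_smul c x, Lp.coeFn_smul c ((H.memLp_mulVec x).toLp _)] with ζ h1 h2 h3 h4
    simp only [RingHom.id_apply]
    rw [h1, h4, Pi.smul_apply, h2, h3, Pi.smul_apply, map_smul]

lemma coeFn_mul (x : X2 n) :
    H.mul x =ᵐ[unitMeasure] fun ζ => Matrix.toEuclideanCLM (𝕜 := ℂ) (H.toFun ζ) (x ζ) :=
  (H.memLp_mulVec x).coeFn_toLp

lemma inner_toEuclideanCLM {M : Matrix (Fin n) (Fin n) ℂ} (v w : EuclideanSpace ℂ (Fin n)) :
    inner ℂ v (Matrix.toEuclideanCLM (𝕜 := ℂ) M w) = star v.ofLp ⬝ᵥ M.mulVec w.ofLp := by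
  rw [EuclideanSpace.inner_eq_star_dotProduct, Matrix.ofLp_toEuclideanCLM, dotProduct_comm]

lemma inner_mul_symm (x y : X2 n) : inner ℂ x (H.mul y) = inner ℂ (H.mul x) y := by
  rw [L2.inner_def, L2.inner_def]
  apply integral_congr_ae
  filter_upwards [H.coeFn_mul x, H.coeFn_mul y, H.posDef] with ζ h1 h2 h3
  rw [h1, h2]
  have hs : ContinuousLinearMap.adjoint (Matrix.toEuclideanCLM (𝕜 := ℂ) (H.toFun ζ))
      = Matrix.toEuclideanCLM (𝕜 := ℂ) (H.toFun ζ) := by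
    rw [← ContinuousLinearMap.star_eq_adjoint, ← map_star, Matrix.star_eq_conjTranspose,
      h3.isHermitian.eq]
  rw [← ContinuousLinearMap.adjoint_inner_left, hs]

lemma re_inner_mul_eq (x : X2 n) : (inner ℂ x (H.mul x)).re =
    ∫ ζ, (inner ℂ (x ζ) (Matrix.toEuclideanCLM (𝕜 := ℂ) (H.toFun ζ) (x ζ))).re ∂unitMeasure := by
  have h := integral_re (L2.integrable_inner (𝕜 := ℂ) x (H.mul x))
  rw [L2.inner_def]
  refine h.symm.trans (integral_congr_ae ?_)
  filter_upwards [H.coeFn_mul x] with ζ h1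
  rw [h1]
  rfl

lemma re_inner_nonneg_ae (x : X2 n) : 0 ≤ᵐ[unitMeasure] fun ζ =>
    (inner ℂ (x ζ) (Matrix.toEuclideanCLM (𝕜 := ℂ) (H.toFun ζ) (x ζ))).re := by
  filter_upwards [H.posDef] with ζ h
  rw [inner_toEuclideanCLM]
  exact h.posSemidef.re_dotProduct_nonneg _

lemma definite (x : X2 n) (hx : inner ℂ x (H.mul x) = 0) : x = 0 := by
  have h0 : (inner ℂ x (H.mul x)).re = 0 := by rw [hx]; rfl
  rw [H.re_inner_mul_eq, integral_eq_zero_iff_of_nonneg_ae (H.re_inner_nonneg_ae x)] at h0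
  · apply (Lp.eq_zero_iff_ae_eq_zero).mpr
    filter_upwards [h0, H.posDef] with ζ h1 h2
    by_contra hne
    have hne' : (x ζ).ofLp ≠ 0 := fun h => hne (by ext i; simp [h])
    rw [inner_toEuclideanCLM] at h1
    exact (h2.re_dotProduct_pos hne').ne' h1
  · refine ((L2.integrable_inner (𝕜 := ℂ) x (H.mul x)).re).congr ?_
    filter_upwards [H.coeFn_mul x] with ζ h1
    rw [h1]
    rfl

/-- The energy space: the vector space `L²(0,1; ℂⁿ)`, to be equipped with the inner product
`⟨x, 𝓗 y⟩` and the norm that it induces (and not with the standard ones). -/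
def EnergySpace (_ : HamiltonianDensity n) : Type := X2 n

instance : AddCommGroup H.EnergySpace := inferInstanceAs (AddCommGroup (X2 n))
instance : Module ℂ H.EnergySpace := inferInstanceAs (Module ℂ (X2 n))

/-- The identity from `L²(0,1; ℂⁿ)` to the energy space. -/
def toEnergy : X2 n ≃ₗ[ℂ] H.EnergySpace := LinearEquiv.refl ℂ (X2 n)

/-- The energy inner product `⟨x, 𝓗 y⟩`. -/
@[reducible] def energyCore : InnerProductSpace.Core ℂ H.EnergySpace where
  inner x y := inner ℂ (H.toEnergy.symm x) (H.mul (H.toEnergy.symm y))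
  conj_inner_symm x y := by rw [inner_conj_symm, inner_mul_symm]
  re_inner_nonneg x := by
    refine le_of_le_of_eq ?_ (H.re_inner_mul_eq _).symm
    exact integral_nonneg_of_ae (H.re_inner_nonneg_ae _)
  add_left x y z := by rw [map_add, inner_add_left]
  smul_left x y r := by rw [map_smul, inner_smul_left]
  definite x hx := H.definite x hx

instance : NormedAddCommGroup H.EnergySpace :=
  @InnerProductSpace.Core.toNormedAddCommGroup ℂ _ _ _ _ H.energyCore

instance : InnerProductSpace ℂ H.EnergySpace :=
  InnerProductSpace.ofCore H.energyCore.toCore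

/-- The operator `A𝓗` on the energy space, with domain `{x | 𝓗 x ∈ D(A)}`. -/
def opAH (A : X2 n →ₗ.[ℂ] X2 n) : H.EnergySpace →ₗ.[ℂ] H.EnergySpace where
  domain := A.domain.comap (H.mul.comp H.toEnergy.symm.toLinearMap)
  toFun := H.toEnergy.toLinearMap.comp (A.toFun.comp
    ((H.mul.comp H.toEnergy.symm.toLinearMap).restrict fun _ hx => hx))

end HamiltonianDensity

end PortHamiltonian

end

/-! A contraction semigroup is quasi-contractive with `w = 0`, so the content lies in the other
direction: quasi-dissipativity of `A𝓗` improves to dissipativity when `Re P₀ ≤ 0`.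

Put `u = 𝓗x`. The energy inner product of `x` with `A𝓗x` is the plain `L²` product `⟨u, Au⟩`, so the
density disappears. Quasi-contractivity thus gives `Re ⟨u, Au⟩ ≤ w ⟨u, 𝓗⁻¹u⟩ ≤ K ‖u‖²` on `D(A)`
(`exists_re_inner_le`). Integration by parts gives the energy balance `two_mul_re_inner_opA`: `2 Re
⟨u, Au⟩` is a quadratic form in the boundary values `u(1)`, `u(0)` plus `2 Re ⟨u, P₀u⟩`. Any
admissible boundary values are attained by elements of `D(A)` of arbitrarily small `L²`-norm
(`exists_mem_domainA_norm_sq_lt`). Along these `K ‖u‖²` and the `P₀` term vanish in the limit while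
the boundary form stays fixed, so that form is nonpositive, and `A` is dissipative
(`re_inner_opA_nonpos`).

Finally, `A𝓗` generates `T(t) = e^{wt} S(t)` with `S` contractive. For `x` in the domain, `‖T(t)x‖²`
has right derivative `2 Re ⟨T(t)x, A𝓗 T(t)x⟩ ≤ 0`, and density of the domain gives `‖T(t)‖ ≤ 1`. -/

noncomputable section

namespace PortHamiltonian

/-! ### Rescaling and orbits of semigroups on a normed space. -/

section AbstractSemigroup

lemma mem_graph_subScalar_iff {E : Type*} [NormedAddCommGroup E] [NormedSpace ℂ E]
    (G : E →ₗ.[ℂ] E) (w : ℝ) (x y : E) :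
    (x, y) ∈ (subScalar G w).graph ↔ (x, y + (w : ℂ) • x) ∈ G.graph := by
  simp only [LinearPMap.mem_graph_iff]
  constructor
  · rintro ⟨v, hv, h⟩
    refine ⟨v, hv, ?_⟩
    have h' : -((w : ℂ) • (v : E)) + G v = y := h
    have hv' : (v : E) = x := hv
    rw [← h', ← hv']
    abel
  · rintro ⟨v, hv, h⟩
    refine ⟨v, hv, ?_⟩
    change -((w : ℂ) • (v : E)) + G v = y
    have hv' : (v : E) = x := hv
    have h' : G v = y + (w : ℂ) • x := h
    rw [h', hv']
    abel

lemma subScalar_zero {E : Type*} [NormedAddCommGroup E] [NormedSpace ℂ E]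
    (G : E →ₗ.[ℂ] E) : subScalar G 0 = G := by
  apply LinearPMap.eq_of_eq_graph
  ext ⟨x, y⟩
  rw [mem_graph_subScalar_iff]
  simp only [Complex.ofReal_zero, zero_smul, add_zero]

variable {E : Type*} [NormedAddCommGroup E] [NormedSpace ℂ E] {T : ℝ → E →L[ℂ] E}

/-- The rescaled semigroup `e^{w t} T(t)`. -/
def expSMul (w : ℝ) (T : ℝ → E →L[ℂ] E) (t : ℝ) : E →L[ℂ] E :=
  (Real.exp (w * t) : ℂ) • T t

lemma expSMul_apply (w : ℝ) (T : ℝ → E →L[ℂ] E) (t : ℝ) (x : E) :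
    expSMul w T t x = (Real.exp (w * t) : ℂ) • T t x := rfl

lemma tendsto_ofReal_exp_mul (w : ℝ) :
    Tendsto (fun t : ℝ => (Real.exp (w * t) : ℂ)) (𝓝[>] 0) (𝓝 1) := by
  have : Continuous fun t : ℝ => (Real.exp (w * t) : ℂ) := by fun_prop
  simpa using (this.tendsto 0).mono_left nhdsWithin_le_nhds

lemma IsC0Semigroup.expSMul (hT : IsC0Semigroup T) (w : ℝ) :
    IsC0Semigroup (expSMul w T) where
  map_zero := by ext x; simp [expSMul_apply, hT.map_zero]
  map_add s t hs ht := by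
    ext x
    simp only [expSMul_apply, hT.map_add s t hs ht, ContinuousLinearMap.comp_apply, map_smul,
      smul_smul, mul_add, Real.exp_add, Complex.ofReal_mul]
    rw [mul_comm]
  tendsto_zero x := by
    simpa [expSMul_apply] using (tendsto_ofReal_exp_mul w).smul (hT.tendsto_zero x)

/-- Product rule: `e^{wt} T(t)x - x = (T(t)x - x) + (e^{wt} - 1) T(t)x`. -/
lemma tendsto_diffQuotient_expSMul {y x : E} (w : ℝ)
    (hT0 : Tendsto (fun t : ℝ => T t x) (𝓝[>] 0) (𝓝 x))
    (h : Tendsto (fun t : ℝ => ((t⁻¹ : ℝ) : ℂ) • (T t x - x)) (𝓝[>] 0) (𝓝 y)) :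
    Tendsto (fun t : ℝ => ((t⁻¹ : ℝ) : ℂ) • (expSMul w T t x - x)) (𝓝[>] 0)
      (𝓝 (y + (w : ℂ) • x)) := by
  have hd : Tendsto (fun t : ℝ => t⁻¹ * (Real.exp (w * t) - 1)) (𝓝[>] 0) (𝓝 w) := by
    have h1 : HasDerivAt (fun t : ℝ => Real.exp (w * t)) w 0 := by
      simpa using ((hasDerivAt_id (0 : ℝ)).const_mul w).exp
    have := h1.tendsto_slope_zero_right
    simpa using this
  have hd' : Tendsto (fun t : ℝ => ((t⁻¹ * (Real.exp (w * t) - 1) : ℝ) : ℂ)) (𝓝[>] 0)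
      (𝓝 (w : ℂ)) := (Complex.continuous_ofReal.tendsto _).comp hd
  refine (h.add (hd'.smul hT0)).congr fun t => ?_
  rw [expSMul_apply, Complex.ofReal_mul, mul_smul, ← smul_add]
  congr 1
  rw [Complex.ofReal_sub, sub_smul, Complex.ofReal_one, one_smul]
  abel

/-- Since rescaling is invertible, one direction of the product rule yields both implications in
`IsGenerator.expSMul`. -/
lemma expSMul_neg_expSMul (w : ℝ) (T : ℝ → E →L[ℂ] E) : expSMul (-w) (expSMul w T) = T := by
  ext t x
  rw [expSMul_apply, expSMul_apply, smul_smul, ← Complex.ofReal_mul, ← Real.exp_add]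
  simp

lemma IsGenerator.expSMul {G : E →ₗ.[ℂ] E} {w : ℝ} (hT : IsC0Semigroup T)
    (hG : IsGenerator T (subScalar G w)) : IsGenerator (expSMul w T) G := by
  intro x y
  have hxy : (x, y) ∈ G.graph ↔ (x, y - (w : ℂ) • x) ∈ (subScalar G w).graph := by
    rw [mem_graph_subScalar_iff, sub_add_cancel]
  rw [hxy, hG]
  constructor
  · intro h
    simpa using tendsto_diffQuotient_expSMul w (hT.tendsto_zero x) h
  · intro h
    have := tendsto_diffQuotient_expSMul (-w) ((hT.expSMul w).tendsto_zero x) h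
    rw [expSMul_neg_expSMul] at this
    simpa [sub_eq_add_neg] using this

lemma IsC0Semigroup.norm_apply_le (hT1 : ∀ t : ℝ, 0 ≤ t → ‖T t‖ ≤ 1) {t : ℝ}
    (ht : 0 ≤ t) (x : E) : ‖T t x‖ ≤ ‖x‖ :=
  ((T t).le_of_opNorm_le (hT1 t ht) x).trans_eq (one_mul _)

/-- Factoring out the contraction at the smaller time bounds every increment by one starting at `0`;
right continuity at `0` then yields two-sided continuity. -/
lemma IsC0Semigroup.norm_sub_le (hT : IsC0Semigroup T) (hT1 : ∀ t : ℝ, 0 ≤ t → ‖T t‖ ≤ 1)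
    {s t : ℝ} (hs : 0 ≤ s) (ht : 0 ≤ t) (x : E) : ‖T t x - T s x‖ ≤ ‖T |t - s| x - x‖ := by
  wlog h : s ≤ t generalizing s t
  · rw [norm_sub_rev, abs_sub_comm]
    exact this ht hs (le_of_not_ge h)
  · have h0 : 0 ≤ t - s := sub_nonneg.mpr h
    have : T t x - T s x = T s (T (t - s) x - x) := by
      rw [map_sub, ← ContinuousLinearMap.comp_apply, ← hT.map_add s _ hs h0, add_sub_cancel]
    rw [this, abs_of_nonneg h0]
    exact norm_apply_le hT1 hs _

lemma IsC0Semigroup.continuousOn_orbit (hT : IsC0Semigroup T)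
    (hT1 : ∀ t : ℝ, 0 ≤ t → ‖T t‖ ≤ 1) (x : E) :
    ContinuousOn (fun t => T t x) (Set.Ici 0) := by
  have h0 : Tendsto (fun t => T t x) (𝓝[≥] 0) (𝓝 x) := by
    -- Strong continuity is assumed for `t > 0` only; the point `t = 0` is supplied by `T 0 = id`.
    rw [← Set.Ioi_insert, nhdsWithin_insert, tendsto_sup]
    refine ⟨?_, hT.tendsto_zero x⟩
    have : T 0 x = x := by rw [hT.map_zero]; rfl
    rw [tendsto_pure_left]
    intro s hs
    rw [this]
    exact mem_of_mem_nhds hs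
  intro s hs
  have h1 : Tendsto (fun t => |t - s|) (𝓝[Set.Ici 0] s) (𝓝[≥] 0) := by
    refine tendsto_nhdsWithin_iff.mpr ⟨?_, Eventually.of_forall fun t => abs_nonneg (t - s)⟩
    have : Continuous fun t => |t - s| := by fun_prop
    simpa using (this.tendsto s).mono_left nhdsWithin_le_nhds
  have h2 := (tendsto_iff_norm_sub_tendsto_zero.mp (h0.comp h1))
  refine tendsto_iff_norm_sub_tendsto_zero.mpr (squeeze_zero' ?_ ?_ h2)
  · exact Eventually.of_forall fun t => norm_nonneg _
  · filter_upwards [self_mem_nhdsWithin] with t ht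
    exact hT.norm_sub_le hT1 hs ht x

/-- `T t` is continuous and commutes with the difference quotients at `0`. -/
lemma IsGenerator.apply_mem_graph {G : E →ₗ.[ℂ] E} (hT : IsC0Semigroup T)
    (hG : IsGenerator T G) {x y : E} (h : (x, y) ∈ G.graph) {t : ℝ} (ht : 0 ≤ t) :
    (T t x, T t y) ∈ G.graph := by
  rw [hG] at h ⊢
  refine (((T t).continuous.tendsto y).comp h).congr' ?_
  filter_upwards [self_mem_nhdsWithin] with s hs
  have hs' : 0 ≤ s := le_of_lt hs
  rw [Function.comp_apply, map_smul, map_sub, ← ContinuousLinearMap.comp_apply,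
    ← ContinuousLinearMap.comp_apply, ← hT.map_add t s ht hs', ← hT.map_add s t hs' ht, add_comm]

/-- For `s > t` the quotient at `t` is the quotient at `0` for the vector `T t x`. A right
derivative suffices for the later comparison argument. -/
lemma IsGenerator.hasDerivWithinAt {G : E →ₗ.[ℂ] E} (hT : IsC0Semigroup T)
    (hG : IsGenerator T G) {x y : E} (h : (x, y) ∈ G.graph) {t : ℝ} (ht : 0 ≤ t) :
    HasDerivWithinAt (fun s => T s x) (T t y) (Set.Ici t) t := by
  rw [← hasDerivWithinAt_Ioi_iff_Ici]
  rw [hasDerivWithinAt_iff_tendsto_slope' (by simp)]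
  have h1 := (hG _ _).mp (hG.apply_mem_graph hT h ht)
  have h2 : Tendsto (fun s => s - t) (𝓝[>] t) (𝓝[>] 0) := by
    refine tendsto_nhdsWithin_iff.mpr ⟨?_, ?_⟩
    · have : Continuous fun s => s - t := by fun_prop
      simpa using (this.tendsto t).mono_left nhdsWithin_le_nhds
    · filter_upwards [self_mem_nhdsWithin] with s hs
      exact sub_pos.mpr (show t < s from hs)
  refine (h1.comp h2).congr' ?_
  filter_upwards [self_mem_nhdsWithin] with s hs
  have hs' : 0 ≤ s - t := (sub_pos.mpr (show t < s from hs)).le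
  rw [Function.comp_apply, slope_def_module, ← ContinuousLinearMap.comp_apply,
    ← hT.map_add _ _ hs' ht, sub_add_cancel, ← Complex.coe_smul]

end AbstractSemigroup

/-! ### Dissipativity and contractivity. -/

section Contraction

variable {E : Type*} [NormedAddCommGroup E] [InnerProductSpace ℂ E] {T : ℝ → E →L[ℂ] E}

/-- The easy half of Lumer–Phillips: by Cauchy–Schwarz `Re ⟨x, T(t)x - x⟩ ≤ 0`; divide by `t` and
let `t ↓ 0`. -/
lemma IsGenerator.re_inner_nonpos {G : E →ₗ.[ℂ] E} (hT1 : ∀ t : ℝ, 0 ≤ t → ‖T t‖ ≤ 1)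
    (hG : IsGenerator T G) {x y : E} (h : (x, y) ∈ G.graph) : (inner ℂ x y).re ≤ 0 := by
  have h1 := (hG x y).mp h
  have h2 : Tendsto (fun t : ℝ => (inner ℂ x (((t⁻¹ : ℝ) : ℂ) • (T t x - x))).re) (𝓝[>] 0)
      (𝓝 (inner ℂ x y).re) :=
    (Complex.continuous_re.tendsto _).comp (tendsto_const_nhds.inner h1)
  refine le_of_tendsto h2 ?_
  filter_upwards [self_mem_nhdsWithin] with t ht
  have ht' : (0 : ℝ) < t := ht
  rw [inner_smul_right, Complex.re_ofReal_mul, inner_sub_right, Complex.sub_re]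
  have h3 : (inner ℂ x (T t x)).re ≤ ‖x‖ * ‖x‖ :=
    (re_inner_le_norm (𝕜 := ℂ) x (T t x)).trans (by
      gcongr; exact IsC0Semigroup.norm_apply_le hT1 ht'.le x)
  have h4 : (inner ℂ x x).re = ‖x‖ * ‖x‖ := inner_self_eq_norm_mul_norm (𝕜 := ℂ) x
  exact mul_nonpos_of_nonneg_of_nonpos (inv_nonneg.mpr ht'.le) (by rw [h4]; linarith)

/-- A dissipative operator is a generator of a contraction semigroup as soon as it is densely
defined and generates a quasi-contractive semigroup. -/
theorem GeneratesQuasiContractiveSemigroup.generatesContractionSemigroup {G : E →ₗ.[ℂ] E}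
    (hG : GeneratesQuasiContractiveSemigroup G) (hd : Dense (G.domain : Set E))
    (hdiss : ∀ x y : E, (x, y) ∈ G.graph → (inner ℂ x y).re ≤ 0) :
    GeneratesContractionSemigroup G := by
  obtain ⟨w, S, hS, hS1, hSG⟩ := hG
  have hT := hS.expSMul w
  have hTG := hSG.expSMul hS
  refine ⟨expSMul w S, hT, fun t ht => ?_, hTG⟩
  refine ContinuousLinearMap.opNorm_le_bound _ zero_le_one fun x => ?_
  rw [one_mul]
  revert x
  refine hd.induction (P := fun x => ‖expSMul w S t x‖ ≤ ‖x‖) ?_ ?_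
  · intro x hx
    have hxy : (x, G ⟨x, hx⟩) ∈ G.graph := G.mem_graph ⟨x, hx⟩
    let _ : InnerProductSpace ℝ E := InnerProductSpace.rclikeToReal ℂ E
    -- Continuity is taken from the contraction semigroup `S`, since contractivity of the rescaled
    -- one is the goal.
    have hc : ContinuousOn (fun s => ‖expSMul w S s x‖ ^ 2) (Set.Icc 0 t) := by
      have h1 := (hS.continuousOn_orbit hS1 x).mono (Set.Icc_subset_Ici_self : Set.Icc 0 t ⊆ _)
      have h2 : Continuous fun s : ℝ => (Real.exp (w * s) : ℂ) := by fun_prop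
      exact ((h2.continuousOn.smul h1).norm).pow 2
    -- Comparison of the squared norm of the orbit, whose right derivative is nonpositive by
    -- dissipativity, with the constant `‖x‖²`.
    have key := image_le_of_deriv_right_le_deriv_boundary (B := fun _ => ‖x‖ ^ 2)
      (B' := fun _ => 0) hc
      (fun s hs => (hTG.hasDerivWithinAt hT hxy hs.1).norm_sq) (by simp [hT.map_zero])
      continuousOn_const (fun s _ => hasDerivWithinAt_const _ _ _)
      (fun s hs => by
        have := hdiss _ _ (hTG.apply_mem_graph hT hxy hs.1)
        have h3 : inner ℝ (expSMul w S s x) (expSMul w S s (G ⟨x, hx⟩))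
          = (inner ℂ (expSMul w S s x) (expSMul w S s (G ⟨x, hx⟩))).re := rfl
        rw [h3]
        linarith) (Set.right_mem_Icc.mpr ht)
    exact le_of_sq_le_sq key (norm_nonneg _)
  · exact isClosed_le (by fun_prop) (by fun_prop)

end Contraction

/-! ### Integration by parts on the unit interval. -/

lemma memLp_of_continuous {E : Type*} [NormedAddCommGroup E] {g : ℝ → E} (hg : Continuous g) (p : ENNReal) :
    MemLp g p unitMeasure := by
  obtain ⟨C, hC⟩ := (isCompact_Icc (a := (0 : ℝ)) (b := 1)).exists_bound_of_continuousOn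
    hg.continuousOn
  refine MemLp.of_bound hg.aestronglyMeasurable C ?_
  filter_upwards [ae_restrict_mem measurableSet_Ioo] with t ht
  exact hC t (Set.Ioo_subset_Icc_self ht)

section Primitive

variable {E F G : Type*} [NormedAddCommGroup E] [NormedSpace ℝ E]
  [NormedAddCommGroup F] [NormedSpace ℝ F]
  [NormedAddCommGroup G] [NormedSpace ℝ G]

/-- The primitive `t ↦ ∫₀ᵗ z` of an integrable function on the unit interval. -/
def primitive (z : ℝ → E) (t : ℝ) : E := ∫ s in Set.Iic t, z s ∂unitMeasure

lemma primitive_eq_intervalIntegral (z : ℝ → E) {t : ℝ} (h0 : 0 ≤ t) (h1 : t ≤ 1) :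
    primitive z t = ∫ s in (0 : ℝ)..t, z s := by
  rw [primitive, Measure.restrict_restrict measurableSet_Iic,
    intervalIntegral.integral_of_le h0, integral_Ioc_eq_integral_Ioo]
  rcases h1.lt_or_eq with h1 | rfl
  · rw [← integral_Ioc_eq_integral_Ioo]
    congr 2
    ext s
    simp only [Set.mem_inter_iff, Set.mem_Iic, Set.mem_Ioo, Set.mem_Ioc]
    constructor
    · rintro ⟨a, b, c⟩; exact ⟨b, a⟩
    · rintro ⟨a, b⟩; exact ⟨b, a, b.trans_lt h1⟩
  · congr 2
    ext s
    simp only [Set.mem_inter_iff, Set.mem_Iic, Set.mem_Ioo]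
    constructor
    · rintro ⟨a, b, c⟩; exact ⟨b, c⟩
    · rintro ⟨a, b⟩; exact ⟨b.le, a, b⟩

lemma primitive_zero (z : ℝ → E) : primitive z 0 = 0 := by
  rw [primitive_eq_intervalIntegral z le_rfl zero_le_one, intervalIntegral.integral_same]

lemma integral_unitMeasure (z : ℝ → E) : ∫ s, z s ∂unitMeasure = ∫ s in (0 : ℝ)..1, z s := by
  rw [intervalIntegral.integral_of_le zero_le_one, integral_Ioc_eq_integral_Ioo]

lemma primitive_one (z : ℝ → E) : primitive z 1 = ∫ s, z s ∂unitMeasure := by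
  rw [primitive_eq_intervalIntegral z zero_le_one le_rfl, integral_unitMeasure]

lemma continuous_primitive {z : ℝ → E} (hz : Integrable z unitMeasure) :
    Continuous (primitive z) := by
  have h : primitive z
      = fun t => (∫ s in (0 : ℝ)..t, z s ∂unitMeasure) + primitive z 0 := by
    ext t
    rw [← intervalIntegral.integral_Iic_sub_Iic hz.integrableOn hz.integrableOn, primitive,
      primitive, sub_add_cancel]
  rw [h]
  exact (hz.continuous_primitive 0).add continuous_const

lemma norm_primitive_le (z : ℝ → E) (hz : Integrable z unitMeasure) (t : ℝ) :
    ‖primitive z t‖ ≤ ∫ s, ‖z s‖ ∂unitMeasure :=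
  (norm_integral_le_integral_norm _).trans
    (setIntegral_le_integral hz.norm (Eventually.of_forall fun _ => norm_nonneg _))

/-- Integration by parts for primitives of integrable functions, by Fubini's theorem. -/
theorem integral_bilin_primitive_add [CompleteSpace E] [CompleteSpace F] [CompleteSpace G]
    (B : E →L[ℝ] F →L[ℝ] G) {z : ℝ → E} {w : ℝ → F}
    (hz : Integrable z unitMeasure) (hw : Integrable w unitMeasure) :
    ∫ t, B (z t) (primitive w t) ∂unitMeasure + ∫ s, B (primitive z s) (w s) ∂unitMeasure
      = B (∫ t, z t ∂unitMeasure) (∫ s, w s ∂unitMeasure) := by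
  have hK : Integrable (fun p : ℝ × ℝ => B (z p.1) (w p.2)) (unitMeasure.prod unitMeasure) :=
    hz.op_fst_snd (op := fun x y => B x y) (by fun_prop) ⟨‖B‖, B.le_opNorm₂⟩ hw
  have hS : MeasurableSet {p : ℝ × ℝ | p.2 ≤ p.1} := measurableSet_le measurable_snd measurable_fst
  -- The right-hand side is the integral of `B (z t) (w s)` over the square. It is split along the
  -- diagonal: over `s ≤ t` the variable `s` is integrated first, over `t < s` the variable `t`.
  rw [← integral_prod_bilin B hz hw, ← integral_add_compl hS hK,
    ← integral_indicator hS, ← integral_indicator hS.compl,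
    integral_prod _ (hK.indicator hS), integral_prod_symm _ (hK.indicator hS.compl)]
  congr 1
  · refine integral_congr_ae (Eventually.of_forall fun t => ?_)
    simp only
    rw [primitive, ← ContinuousLinearMap.integral_comp_comm _ hw.integrableOn,
      ← integral_indicator measurableSet_Iic]
    rfl
  · refine integral_congr_ae (Eventually.of_forall fun s => ?_)
    simp only
    -- The complementary triangle is strict, and the point `t = s` is null.
    rw [primitive, integral_Iic_eq_integral_Iio, ← ContinuousLinearMap.flip_apply,
      ← ContinuousLinearMap.integral_comp_comm _ hz.integrableOn,
      ← integral_indicator measurableSet_Iio]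
    refine integral_congr_ae (Eventually.of_forall fun t => ?_)
    simp only [Set.indicator, Set.mem_Iio, Set.mem_compl_iff, Set.mem_ofPred_eq, not_le,
      ContinuousLinearMap.flip_apply]

/-- For a symmetric bilinear form `B` and `f = c + ∫₀ᵗ z` one has
`2 ∫ B(z, f) = B(f(1), f(1)) - B(f(0), f(0))`. -/
theorem two_mul_integral_bilin_primitive [CompleteSpace E] (B : E →L[ℝ] E →L[ℝ] ℝ)
    (hB : ∀ v w, B v w = B w v) {z f : ℝ → E} (hz : Integrable z unitMeasure)
    (hf : ∀ t ∈ Set.Icc (0 : ℝ) 1, f t = f 0 + primitive z t) :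
    2 * ∫ t, B (z t) (f t) ∂unitMeasure = B (f 1) (f 1) - B (f 0) (f 0) := by
  have h1 : ∫ t, B (z t) (f t) ∂unitMeasure
      = ∫ t, (B (z t) (f 0) + B (z t) (primitive z t)) ∂unitMeasure := by
    refine integral_congr_ae ?_
    filter_upwards [ae_restrict_mem measurableSet_Ioo] with t ht
    rw [hf t (Set.Ioo_subset_Icc_self ht), map_add]
  have hi1 : Integrable (fun t => B (z t) (f 0)) unitMeasure := (B.flip (f 0)).integrable_comp hz
  have hi2 : Integrable (fun t => B (z t) (primitive z t)) unitMeasure := by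
    refine (hz.norm.mul_const (‖B‖ * ∫ s, ‖z s‖ ∂unitMeasure)).mono' ?_ ?_
    · exact B.aestronglyMeasurable_comp₂ hz.1 (continuous_primitive hz).aestronglyMeasurable
    · refine Eventually.of_forall fun t => (B.le_opNorm₂ _ _).trans ?_
      have := norm_primitive_le z hz t
      calc ‖B‖ * ‖z t‖ * ‖primitive z t‖ ≤ ‖B‖ * ‖z t‖ * ∫ s, ‖z s‖ ∂unitMeasure := by gcongr
        _ = _ := by ring
  -- With `w = z` and `B` symmetric the two integrals coincide, which produces the factor `2`.
  have h2 := integral_bilin_primitive_add B hz hz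
  have h3 : ∫ s, B (primitive z s) (z s) ∂unitMeasure = ∫ s, B (z s) (primitive z s) ∂unitMeasure :=
    integral_congr_ae (Eventually.of_forall fun s => hB _ _)
  have h4 : ∫ t, B (z t) (f 0) ∂unitMeasure = B (∫ t, z t ∂unitMeasure) (f 0) :=
    (B.flip (f 0)).integral_comp_comm hz
  rw [h3] at h2
  rw [h1, integral_add hi1 hi2, h4, hf 1 (by simp), primitive_one]
  simp only [map_add, add_apply]
  rw [hB (f 0) (∫ t, z t ∂unitMeasure)]
  linarith

/-- A function on the unit interval whose weak derivative vanishes is a.e. constant. -/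
theorem ae_eq_const_of_integral_deriv_smul_eq_zero [CompleteSpace E] {w : ℝ → E}
    (hw : Integrable w unitMeasure)
    (h : ∀ φ : ℝ → ℝ, ContDiff ℝ ∞ φ → HasCompactSupport φ → tsupport φ ⊆ Set.Ioo 0 1 →
      ∫ ζ, deriv φ ζ • w ζ ∂unitMeasure = 0) :
    ∃ c, w =ᵐ[unitMeasure] fun _ => c := by
  -- A bump supported in `[1/4, 3/4]`, normalised to integral `1`; the constant sought is `w` tested
  -- against it.
  let b : ContDiffBump (1 / 2 : ℝ) := ⟨1 / 8, 1 / 4, by norm_num, by norm_num⟩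
  set ψ₀ : ℝ → ℝ := b.normed volume with hψ₀
  have hψ₀s : ContDiff ℝ ∞ ψ₀ := b.contDiff_normed
  have hψ₀c : HasCompactSupport ψ₀ := b.hasCompactSupport_normed
  have hψ₀t : tsupport ψ₀ = Metric.closedBall (1 / 2) (1 / 4) := b.tsupport_normed_eq
  have hψ₀i : ∫ t, ψ₀ t = 1 := b.integral_normed
  have hint : ∀ {φ : ℝ → ℝ}, Continuous φ → HasCompactSupport φ →
      Integrable (fun t => φ t • w t) unitMeasure := by
    intro φ hφ hc
    obtain ⟨C, hC⟩ := hφ.bounded_above_of_compact_support hc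
    exact hw.bdd_smul C hφ.aestronglyMeasurable (Eventually.of_forall hC)
  refine ⟨∫ t, ψ₀ t • w t ∂unitMeasure, ?_⟩
  set c := ∫ t, ψ₀ t • w t ∂unitMeasure with hc
  have hi : Integrable (fun t => w t - c) unitMeasure := hw.sub (integrable_const c)
  have key := isOpen_Ioo.ae_eq_zero_of_integral_contDiff_smul_eq_zero
    (U := Set.Ioo (0 : ℝ) 1) (hi.integrableOn.locallyIntegrableOn) ?_
  · filter_upwards [key, ae_restrict_mem measurableSet_Ioo] with t h hm
    exact sub_eq_zero.mp (h hm)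
  intro ψ hψs hψc hψt
  set m := ∫ t, ψ t with hm
  have hψm : ∫ t, ψ t ∂unitMeasure = m :=
    setIntegral_eq_integral_of_forall_compl_eq_zero fun t ht =>
      image_eq_zero_of_notMem_tsupport fun h => ht (hψt h)
  -- Removing the mean of `ψ` makes its primitive compactly supported in `(0,1)`, hence an
  -- admissible test function with derivative `g`.
  set g : ℝ → ℝ := fun t => ψ t - m * ψ₀ t with hg
  have hgs : ContDiff ℝ ∞ g := hψs.sub (contDiff_const.mul hψ₀s)
  have hg0 : ∫ t, g t = 0 := by
    rw [hg, integral_sub (hψs.continuous.integrable_of_hasCompactSupport hψc)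
      ((hψ₀s.continuous.integrable_of_hasCompactSupport hψ₀c).const_mul m), integral_const_mul,
      hψ₀i, mul_one, sub_self]
  have hKc : IsCompact (tsupport ψ ∪ tsupport ψ₀) := hψc.isCompact.union hψ₀c.isCompact
  have hKn : (tsupport ψ ∪ tsupport ψ₀).Nonempty :=
    ⟨1 / 2, Or.inr (by rw [hψ₀t]; exact Metric.mem_closedBall_self (by norm_num))⟩
  have hKs : tsupport ψ ∪ tsupport ψ₀ ⊆ Set.Ioo 0 1 := by
    refine Set.union_subset hψt ?_
    rw [hψ₀t, Real.closedBall_eq_Icc]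
    exact Set.Icc_subset_Ioo (by norm_num) (by norm_num)
  obtain ⟨α, hα⟩ := hKc.exists_isLeast hKn
  obtain ⟨β, hβ⟩ := hKc.exists_isGreatest hKn
  have hα0 := hKs hα.1
  have hβ0 := hKs hβ.1
  have hgz : ∀ t, t ∉ Set.Icc α β → g t = 0 := by
    intro t ht
    have h1 : t ∉ tsupport ψ := fun h => ht ⟨hα.2 (Or.inl h), hβ.2 (Or.inl h)⟩
    have h2 : t ∉ tsupport ψ₀ := fun h => ht ⟨hα.2 (Or.inr h), hβ.2 (Or.inr h)⟩
    simp [hg, image_eq_zero_of_notMem_tsupport h1, image_eq_zero_of_notMem_tsupport h2]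
  set φ : ℝ → ℝ := fun x => ∫ t in (0 : ℝ)..x, g t with hφ
  have hφd : ∀ x, HasDerivAt φ (g x) x := fun x =>
    hgs.continuous.integral_hasStrictDerivAt 0 x |>.hasDerivAt
  have hφ' : deriv φ = g := funext fun x => (hφd x).deriv
  have hφs : ContDiff ℝ ∞ φ :=
    contDiff_infty_iff_deriv.mpr ⟨fun x => (hφd x).differentiableAt, hφ' ▸ hgs⟩
  have hφz : ∀ x, x ∉ Set.Icc α β → φ x = 0 := by
    intro x hx
    rcases lt_or_ge x α with hxα | hxα
    · rw [hφ]
      have : Set.EqOn g 0 (Set.uIcc 0 x) := fun t ht =>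
        hgz t fun h => absurd (h.1.trans ht.2) (not_le.mpr (max_lt hα0.1 hxα))
      simp only
      rw [intervalIntegral.integral_congr this]
      simp
    · have hxβ : β < x := not_le.mp fun h => hx ⟨hxα, h⟩
      rw [hφ]
      simp only
      rw [intervalIntegral.integral_eq_integral_of_support_subset, hg0]
      intro t ht
      have : t ∈ Set.Icc α β := by
        by_contra h
        exact ht (hgz t h)
      exact ⟨hα0.1.trans_le this.1, this.2.trans hxβ.le⟩
  have hφt : tsupport φ ⊆ Set.Icc α β :=
    closure_minimal (fun x hx => by by_contra h; exact hx (hφz x h)) isClosed_Icc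
  have h0 := h φ hφs (HasCompactSupport.intro isCompact_Icc hφz)
    (hφt.trans (Set.Icc_subset_Ioo hα0.1 hβ0.2))
  rw [hφ'] at h0
  have e1 : ∫ t, g t • w t ∂unitMeasure
      = ∫ t, ψ t • w t ∂unitMeasure - m • c := by
    have hi₀ : Integrable (fun t => m • ψ₀ t • w t) unitMeasure :=
      (hint hψ₀s.continuous hψ₀c).smul m
    rw [hc, ← integral_smul, ← integral_sub (hint hψs.continuous hψc) hi₀]
    refine integral_congr_ae (Eventually.of_forall fun t => ?_)
    simp only [hg, sub_smul, mul_smul]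
  have e2 : ∫ t, ψ t • (w t - c) ∂unitMeasure = ∫ t, ψ t • w t ∂unitMeasure - m • c := by
    simp_rw [smul_sub]
    have hψi : Integrable ψ unitMeasure :=
      (hψs.continuous.integrable_of_hasCompactSupport hψc).integrableOn
    rw [integral_sub (hint hψs.continuous hψc) (hψi.smul_const c), integral_smul_const, hψm]
  change ∫ t, ψ t • (w t - c) ∂unitMeasure = 0
  rw [e2, ← e1, h0]

end Primitive

/-! ### Weak derivatives and continuous representatives. -/

section WeakDeriv

variable {n : ℕ}

lemma eq_zero_of_tsupport_subset_Ioo {φ : ℝ → ℝ} (h : tsupport φ ⊆ Set.Ioo 0 1) :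
    φ 0 = 0 ∧ φ 1 = 0 :=
  ⟨image_eq_zero_of_notMem_tsupport fun h0 => lt_irrefl _ (h h0).1,
    image_eq_zero_of_notMem_tsupport fun h1 => lt_irrefl _ (h h1).2⟩

lemma X2.integrable (x : X2 n) : Integrable x unitMeasure :=
  (Lp.memLp x).integrable (by norm_num)

/-- Fundamental theorem of calculus for the continuous representative of a Sobolev function. -/
theorem HasWeakDeriv.eq_add_primitive {x z : X2 n} (hxz : HasWeakDeriv x z)
    {f : ℝ → EuclideanSpace ℂ (Fin n)} (hf : IsContinuousRep x f) :
    ∀ t ∈ Set.Icc (0 : ℝ) 1, f t = f 0 + primitive z t := by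
  have hz := X2.integrable z
  have hp : Integrable (primitive z) unitMeasure :=
    (memLp_of_continuous (continuous_primitive hz) 1).integrable le_rfl
  -- `x` minus the primitive of `z` has zero weak derivative: integration by parts leaves no
  -- boundary term, as `φ` vanishes at `0` and `1`.
  obtain ⟨c, hc⟩ := ae_eq_const_of_integral_deriv_smul_eq_zero
    (w := fun t => x t - primitive z t) ((X2.integrable x).sub hp) (by
      intro φ hs hcs ht
      have hd : Continuous (deriv φ) := hs.continuous_deriv (by simp)
      have hdi : Integrable (deriv φ) unitMeasure :=
        (memLp_of_continuous hd 1).integrable le_rfl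
      have hφd : ∀ t, 0 ≤ t → t ≤ 1 → primitive (deriv φ) t = φ t := by
        intro t h0 h1
        rw [primitive_eq_intervalIntegral _ h0 h1, intervalIntegral.integral_deriv_eq_sub
          (fun s _ => (hs.differentiable (by simp)).differentiableAt) (hd.intervalIntegrable _ _),
          (eq_zero_of_tsupport_subset_Ioo ht).1, sub_zero]
      have h1 := integral_bilin_primitive_add
        (ContinuousLinearMap.lsmul ℝ ℝ : ℝ →L[ℝ] EuclideanSpace ℂ (Fin n) →L[ℝ] _) hdi hz
      simp only [ContinuousLinearMap.lsmul_apply] at h1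
      rw [← primitive_one (deriv φ), hφd 1 zero_le_one le_rfl,
        (eq_zero_of_tsupport_subset_Ioo ht).2, zero_smul] at h1
      have h2 : ∫ s, primitive (deriv φ) s • z s ∂unitMeasure = ∫ s, φ s • z s ∂unitMeasure := by
        refine integral_congr_ae ?_
        filter_upwards [ae_restrict_mem measurableSet_Ioo] with t ht
        rw [hφd t ht.1.le ht.2.le]
      have hb : Integrable (fun t => deriv φ t • primitive z t) unitMeasure :=
        (memLp_of_continuous (hd.smul (continuous_primitive hz)) 1).integrable le_rfl
      simp_rw [smul_sub]
      rw [integral_sub (integrable_smul x hd hcs.deriv) hb, hxz φ hs hcs ht]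
      rw [h2] at h1
      rw [← neg_add', add_comm, h1, neg_zero])
  have hae : f =ᵐ[volume.restrict (Set.Icc 0 1)] fun t => c + primitive z t := by
    rw [← restrict_Ioo_eq_restrict_Icc]
    filter_upwards [hc, hf.2] with t h1 h2
    rw [← h1, ← h2, sub_add_cancel]
  -- Continuity upgrades a.e. equality to equality on all of `[0,1]`, endpoints included.
  have heq := Measure.eqOn_Icc_of_ae_eq volume zero_ne_one hae hf.1
    (continuous_const.add (continuous_primitive hz)).continuousOn
  have h0 : f 0 = c := by
    rw [heq (by simp : (0 : ℝ) ∈ Set.Icc (0 : ℝ) 1)]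
    simp [primitive_zero]
  intro t ht
  rw [h0, heq ht]

/-- Continuously differentiable functions have their derivative as weak derivative. -/
lemma hasWeakDeriv_of_hasDerivAt {x z : X2 n} {g g' : ℝ → EuclideanSpace ℂ (Fin n)}
    (hg : ∀ t, HasDerivAt g (g' t) t) (hg' : Continuous g')
    (hx : x =ᵐ[unitMeasure] g) (hz : z =ᵐ[unitMeasure] g') : HasWeakDeriv x z := by
  intro φ hs hc ht
  have hgc : Continuous g := continuous_iff_continuousAt.mpr fun t => (hg t).continuousAt
  have hd : Continuous (deriv φ) := hs.continuous_deriv (by simp)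
  have e1 : ∫ ζ, deriv φ ζ • x ζ ∂unitMeasure = ∫ ζ, deriv φ ζ • g ζ ∂unitMeasure :=
    integral_congr_ae (by filter_upwards [hx] with t h; rw [h])
  have e2 : ∫ ζ, φ ζ • z ζ ∂unitMeasure = ∫ ζ, φ ζ • g' ζ ∂unitMeasure :=
    integral_congr_ae (by filter_upwards [hz] with t h; rw [h])
  have h := intervalIntegral.integral_eq_sub_of_hasDerivAt (a := 0) (b := 1)
    (fun t _ => ((hs.differentiable (by simp)).differentiableAt.hasDerivAt (x := t)).smul (hg t))
    (((hs.continuous.smul hg').add (hd.smul hgc)).intervalIntegrable _ _)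
  simp only [Pi.smul_apply', (eq_zero_of_tsupport_subset_Ioo ht).1,
    (eq_zero_of_tsupport_subset_Ioo ht).2, zero_smul, sub_zero] at h
  have i1 : Integrable (fun t => φ t • g' t) unitMeasure :=
    (memLp_of_continuous (hs.continuous.smul hg') 1).integrable le_rfl
  have i2 : Integrable (fun t => deriv φ t • g t) unitMeasure :=
    (memLp_of_continuous (hd.smul hgc) 1).integrable le_rfl
  rw [← integral_unitMeasure, integral_add i1 i2] at h
  rw [e1, e2, eq_neg_iff_add_eq_zero, add_comm]
  exact h

end WeakDeriv

/-! ### Energy balance, density and dissipativity for `A`. -/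

section OperatorA

variable {n : ℕ}

lemma coeFn_constMul (P : Matrix (Fin n) (Fin n) ℂ) (x : X2 n) :
    constMul P x =ᵐ[unitMeasure] fun ζ => Matrix.toEuclideanCLM (𝕜 := ℂ) P (x ζ) :=
  (Matrix.toEuclideanCLM (𝕜 := ℂ) P).coeFn_compLpL x

lemma exists_norm_constMul_le (P : Matrix (Fin n) (Fin n) ℂ) :
    ∃ C, 0 ≤ C ∧ ∀ x : X2 n, ‖constMul P x‖ ≤ C * ‖x‖ :=
  ⟨_, norm_nonneg _,
    ((Matrix.toEuclideanCLM (𝕜 := ℂ) P).compLpL 2 unitMeasure : X2 n →L[ℂ] X2 n).le_opNorm⟩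

/-- The real bilinear form `(v, w) ↦ Re ⟨w, P v⟩`. -/
def reForm (P : Matrix (Fin n) (Fin n) ℂ) :
    EuclideanSpace ℂ (Fin n) →L[ℝ] EuclideanSpace ℂ (Fin n) →L[ℝ] ℝ :=
  LinearMap.mkContinuous₂
    (LinearMap.mk₂ ℝ (fun v w => (inner ℂ w (Matrix.toEuclideanCLM (𝕜 := ℂ) P v)).re)
      (by intro v v' w; simp only [map_add, inner_add_right, Complex.add_re])
      (by
        intro c v w
        rw [← Complex.coe_smul, map_smul, inner_smul_right, Complex.re_ofReal_mul, smul_eq_mul])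
      (by intro v w w'; simp only [inner_add_left, Complex.add_re])
      (by
        intro c v w
        rw [← Complex.coe_smul, inner_smul_left, Complex.conj_ofReal, Complex.re_ofReal_mul,
          smul_eq_mul]))
    ‖Matrix.toEuclideanCLM (𝕜 := ℂ) P‖ (by
      intro v w
      refine (Complex.abs_re_le_norm _).trans ((norm_inner_le_norm _ _).trans ?_)
      rw [mul_comm]
      gcongr
      exact ContinuousLinearMap.le_opNorm _ _)

lemma reForm_apply (P : Matrix (Fin n) (Fin n) ℂ) (v w : EuclideanSpace ℂ (Fin n)) :
    reForm P v w = (inner ℂ w (Matrix.toEuclideanCLM (𝕜 := ℂ) P v)).re := rfl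

lemma reForm_comm {P : Matrix (Fin n) (Fin n) ℂ} (hP : P.IsHermitian)
    (v w : EuclideanSpace ℂ (Fin n)) : reForm P v w = reForm P w v := by
  have hs : ContinuousLinearMap.adjoint (Matrix.toEuclideanCLM (𝕜 := ℂ) P)
      = Matrix.toEuclideanCLM (𝕜 := ℂ) P := by
    rw [← ContinuousLinearMap.star_eq_adjoint, ← map_star, Matrix.star_eq_conjTranspose, hP.eq]
  rw [reForm_apply, reForm_apply, ← ContinuousLinearMap.adjoint_inner_left, hs,
    ← inner_conj_symm, Complex.conj_re]

lemma re_inner_eq_integral (x y : X2 n) :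
    (inner ℂ x y).re = ∫ ζ, (inner ℂ (x ζ) (y ζ)).re ∂unitMeasure := by
  rw [L2.inner_def]
  exact (integral_re (L2.integrable_inner (𝕜 := ℂ) x y)).symm

/-- Pointwise, `v*P*v` is the conjugate of `v*Pv`, so `Re (v*Pv)` is the quadratic form of the
Hermitian part of `P`. -/
lemma re_inner_constMul_nonpos {P : Matrix (Fin n) (Fin n) ℂ}
    (hP : (-((1 / 2 : ℂ) • (P + P.conjTranspose))).PosSemidef) (x : X2 n) :
    (inner ℂ x (constMul P x)).re ≤ 0 := by
  rw [re_inner_eq_integral]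
  refine integral_nonpos_of_ae ?_
  filter_upwards [coeFn_constMul P x] with ζ h
  rw [h, HamiltonianDensity.inner_toEuclideanCLM, Pi.zero_apply]
  set v := (x ζ).ofLp
  have h1 := hP.re_dotProduct_nonneg v
  have h2 : star v ⬝ᵥ P.conjTranspose.mulVec v = star (star v ⬝ᵥ P.mulVec v) := by
    rw [Matrix.star_dotProduct, Matrix.star_mulVec, Matrix.conjTranspose_conjTranspose, ← Matrix.dotProduct_mulVec]
  rw [Matrix.neg_mulVec, Matrix.smul_mulVec, Matrix.add_mulVec, dotProduct_neg,
    dotProduct_smul, dotProduct_add, h2] at h1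
  simp at h1
  linarith

/-- The energy balance of `A`. -/
theorem two_mul_re_inner_opA {P₁ : Matrix (Fin n) (Fin n) ℂ} (hP₁ : P₁.IsHermitian)
    (P₀ : Matrix (Fin n) (Fin n) ℂ) (W : Matrix (Fin n) (Fin n ⊕ Fin n) ℂ)
    (u : (opA P₁ P₀ W).domain) {f : ℝ → EuclideanSpace ℂ (Fin n)}
    (hf : IsContinuousRep (u : X2 n) f) :
    2 * (inner ℂ (u : X2 n) (opA P₁ P₀ W u)).re
      = reForm P₁ (f 1) (f 1) - reForm P₁ (f 0) (f 0)
        + 2 * (inner ℂ (u : X2 n) (constMul P₀ u)).re := by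
  have e : opA P₁ P₀ W u = constMul P₁ (derivA W u) + constMul P₀ (u : X2 n) := rfl
  rw [e, inner_add_right, Complex.add_re, mul_add]
  congr 1
  rw [← two_mul_integral_bilin_primitive (reForm P₁) (reForm_comm hP₁)
    (X2.integrable (derivA W u)) ((derivA_spec W u).eq_add_primitive hf), re_inner_eq_integral]
  congr 1
  refine integral_congr_ae ?_
  filter_upwards [coeFn_constMul P₁ (derivA W u), hf.2] with ζ h1 h2
  rw [h1, h2, reForm_apply]

lemma toLp_mem_domainA {W : Matrix (Fin n) (Fin n ⊕ Fin n) ℂ}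
    {g g' : ℝ → EuclideanSpace ℂ (Fin n)} (hg : ∀ t, HasDerivAt g (g' t) t) (hg' : Continuous g')
    (hgL : MemLp g 2 unitMeasure) (hW : W.mulVec (Sum.elim (g 1) (g 0)) = 0) :
    hgL.toLp g ∈ domainA W := by
  have hgc : Continuous g := continuous_iff_continuousAt.mpr fun t => (hg t).continuousAt
  exact ⟨⟨(memLp_of_continuous hg' 2).toLp g', hasWeakDeriv_of_hasDerivAt hg hg' hgL.coeFn_toLp
    (MemLp.coeFn_toLp _)⟩, g, ⟨hgc.continuousOn, hgL.coeFn_toLp⟩, hW⟩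

/-- For a test function `φ` the boundary values of `φ v` vanish, so it lies in the domain whatever
`W` is; only `0` is orthogonal to all of these. -/
theorem dense_domainA (W : Matrix (Fin n) (Fin n ⊕ Fin n) ℂ) :
    Dense (domainA W : Set (X2 n)) := by
  rw [Submodule.dense_iff_topologicalClosure_eq_top, Submodule.topologicalClosure_eq_top_iff,
    Submodule.eq_bot_iff]
  intro y hy
  rw [Submodule.mem_orthogonal] at hy
  have key := isOpen_Ioo.ae_eq_zero_of_integral_contDiff_smul_eq_zero
    (U := Set.Ioo (0 : ℝ) 1) ((X2.integrable y).integrableOn.locallyIntegrableOn) ?_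
  · rw [Lp.eq_zero_iff_ae_eq_zero]
    filter_upwards [key, ae_restrict_mem measurableSet_Ioo] with ζ h hm
    exact h hm
  intro φ hs hc ht
  change ∫ ζ, φ ζ • y ζ ∂unitMeasure = 0
  have hd : Continuous (deriv φ) := hs.continuous_deriv (by simp)
  refine ext_inner_left ℂ fun v => ?_
  have hgL : MemLp (fun t => φ t • v) 2 unitMeasure :=
    memLp_of_continuous (hs.continuous.smul continuous_const) 2
  have hmem := toLp_mem_domainA (W := W) (g := fun t => φ t • v) (g' := fun t => deriv φ t • v)
    (fun t => ((hs.differentiable (by simp)).differentiableAt.hasDerivAt (x := t)).smul_const v)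
    (hd.smul continuous_const) hgL (by
      have : Sum.elim (φ 1 • v).ofLp (φ 0 • v).ofLp = 0 := by
        rw [(eq_zero_of_tsupport_subset_Ioo ht).1, (eq_zero_of_tsupport_subset_Ioo ht).2]
        ext i; rcases i with i | i <;> simp
      rw [this, Matrix.mulVec_zero])
  have h := hy _ hmem
  rw [L2.inner_def] at h
  rw [inner_zero_right, ← integral_inner (integrable_smul y hs.continuous hc), ← h]
  refine integral_congr_ae ?_
  filter_upwards [hgL.coeFn_toLp] with ζ h1
  rw [h1, ← Complex.coe_smul, ← Complex.coe_smul, inner_smul_left, inner_smul_right,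
    Complex.conj_ofReal]

/-- Continuously differentiable functions on `[0,1]` with prescribed boundary values and small
`L²`-norm. -/
theorem exists_mem_domainA_norm_sq_lt {W : Matrix (Fin n) (Fin n ⊕ Fin n) ℂ}
    {a b : EuclideanSpace ℂ (Fin n)} (hW : W.mulVec (Sum.elim a b) = 0) {ε : ℝ} (hε : 0 < ε) :
    ∃ u ∈ domainA W, ∃ g, IsContinuousRep u g ∧ g 1 = a ∧ g 0 = b ∧ ‖u‖ ^ 2 < ε := by
  -- These tend to `0` pointwise on `(0,1)` and are dominated by `‖a‖ + ‖b‖`. The exponent `k + 1`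
  -- is positive, so each power vanishes at the opposite endpoint even for `k = 0`.
  let g : ℕ → ℝ → EuclideanSpace ℂ (Fin n) := fun k t => t ^ (k + 1) • a + (1 - t) ^ (k + 1) • b
  have hgc : ∀ k, Continuous (g k) := fun k => by fun_prop
  have hg1 : ∀ k, g k 1 = a := fun k => by simp [g]
  have hg0 : ∀ k, g k 0 = b := fun k => by simp [g]
  have hgL : ∀ k, MemLp (g k) 2 unitMeasure := fun k => memLp_of_continuous (hgc k) 2
  have hder : ∀ k t, HasDerivAt (g k)
      ((((k + 1 : ℕ) : ℝ) * t ^ k) • a + (-(((k + 1 : ℕ) : ℝ) * (1 - t) ^ k)) • b) t := by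
    intro k t
    have h1 := (hasDerivAt_pow (k + 1) t).smul_const a
    have h2 := (((hasDerivAt_id t).const_sub 1).pow (k + 1)).smul_const b
    refine (h1.add h2).congr_deriv ?_
    simp
  have hlim : Tendsto (fun k => inner ℂ ((hgL k).toLp (g k)) ((hgL k).toLp (g k))) atTop
      (𝓝 (0 : ℂ)) := by
    have e : ∀ k, inner ℂ ((hgL k).toLp (g k)) ((hgL k).toLp (g k))
        = ∫ t, inner ℂ (g k t) (g k t) ∂unitMeasure := by
      intro k
      rw [L2.inner_def]
      refine integral_congr_ae ?_
      filter_upwards [(hgL k).coeFn_toLp] with t h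
      rw [h]
    simp_rw [e]
    rw [← integral_zero ℝ ℂ (μ := unitMeasure)]
    refine tendsto_integral_of_dominated_convergence (fun _ => (‖a‖ + ‖b‖) * (‖a‖ + ‖b‖))
      (fun k => ((hgc k).inner (hgc k)).aestronglyMeasurable) (integrable_const _) ?_ ?_
    · intro k
      filter_upwards [ae_restrict_mem measurableSet_Ioo] with t ht
      have h1 : ‖g k t‖ ≤ ‖a‖ + ‖b‖ := by
        refine (norm_add_le _ _).trans (add_le_add ?_ ?_)
        · rw [norm_smul]
          refine mul_le_of_le_one_left (norm_nonneg _) ?_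
          rw [norm_pow, Real.norm_eq_abs]
          exact pow_le_one₀ (abs_nonneg _) (abs_le.mpr ⟨by linarith [ht.1], ht.2.le⟩)
        · rw [norm_smul]
          refine mul_le_of_le_one_left (norm_nonneg _) ?_
          rw [norm_pow, Real.norm_eq_abs]
          exact pow_le_one₀ (abs_nonneg _) (abs_le.mpr ⟨by linarith [ht.2], by linarith [ht.1]⟩)
      exact (norm_inner_le_norm _ _).trans (mul_le_mul h1 h1 (norm_nonneg _) (by positivity))
    · filter_upwards [ae_restrict_mem measurableSet_Ioo] with t ht
      have h1 : Tendsto (fun k : ℕ => t ^ (k + 1)) atTop (𝓝 0) :=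
        (tendsto_pow_atTop_nhds_zero_of_lt_one ht.1.le ht.2).comp (tendsto_add_atTop_nat 1)
      have h2 : Tendsto (fun k : ℕ => (1 - t) ^ (k + 1)) atTop (𝓝 0) :=
        (tendsto_pow_atTop_nhds_zero_of_lt_one (by linarith [ht.2]) (by linarith [ht.1])).comp
          (tendsto_add_atTop_nat 1)
      have h3 : Tendsto (fun k => g k t) atTop (𝓝 0) := by
        simpa using (h1.smul_const a).add (h2.smul_const b)
      simpa using h3.inner (𝕜 := ℂ) h3
  have hlim' := (Complex.continuous_re.tendsto _).comp hlim
  obtain ⟨k, hk⟩ := (hlim'.eventually (gt_mem_nhds (by simpa using hε))).exists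
  refine ⟨(hgL k).toLp (g k), toLp_mem_domainA (hder k) (by fun_prop) (hgL k)
    (by rw [hg1, hg0, hW]), g k, ⟨(hgc k).continuousOn, (hgL k).coeFn_toLp⟩, hg1 k, hg0 k, ?_⟩
  exact (inner_self_eq_norm_sq (𝕜 := ℂ) _).symm.trans_lt hk

/-- If `Re P₀ ≤ 0`, then `A` is dissipative as soon as it is quasi-dissipative. -/
theorem re_inner_opA_nonpos {P₁ P₀ : Matrix (Fin n) (Fin n) ℂ} (hP₁ : P₁.IsHermitian)
    (hP₀ : (-((1 / 2 : ℂ) • (P₀ + P₀.conjTranspose))).PosSemidef)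
    {W : Matrix (Fin n) (Fin n ⊕ Fin n) ℂ} {K : ℝ}
    (hK : ∀ u : (opA P₁ P₀ W).domain, (inner ℂ (u : X2 n) (opA P₁ P₀ W u)).re
      ≤ K * ‖(u : X2 n)‖ ^ 2)
    (u : (opA P₁ P₀ W).domain) : (inner ℂ (u : X2 n) (opA P₁ P₀ W u)).re ≤ 0 := by
  obtain ⟨-, f, hf, hW⟩ := u.2
  have hb := two_mul_re_inner_opA hP₁ P₀ W u hf
  have h0 := re_inner_constMul_nonpos hP₀ (u : X2 n)
  suffices reForm P₁ (f 1) (f 1) - reForm P₁ (f 0) (f 0) ≤ 0 by linarith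
  obtain ⟨C, hC0, hC⟩ := exists_norm_constMul_le P₀
  refine le_of_forall_pos_le_add fun δ hδ => ?_
  -- For `v` with the boundary values of `u`, the boundary form is at most `2 (|K| + C) ‖v‖²`; the
  -- `+ 1` only keeps the divisor positive.
  have hM : 0 < 2 * (|K| + C) + 1 := by positivity
  obtain ⟨v, hv, g, hg, hg1, hg0, hlt⟩ := exists_mem_domainA_norm_sq_lt hW (div_pos hδ hM)
  have hb' := two_mul_re_inner_opA hP₁ P₀ W ⟨v, hv⟩ hg
  have hK' := hK ⟨v, hv⟩
  simp only [hg1, hg0] at hb' hK'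
  have h1 : |(inner ℂ v (constMul P₀ v)).re| ≤ C * ‖v‖ ^ 2 := by
    refine (Complex.abs_re_le_norm _).trans ((norm_inner_le_norm _ _).trans ?_)
    calc ‖v‖ * ‖constMul P₀ v‖ ≤ ‖v‖ * (C * ‖v‖) := by gcongr; exact hC v
      _ = C * ‖v‖ ^ 2 := by ring
  have h2 := (abs_le.mp h1).1
  have h3 : K * ‖v‖ ^ 2 ≤ |K| * ‖v‖ ^ 2 := by gcongr; exact le_abs_self K
  rw [lt_div_iff₀ hM] at hlt
  have h4 := sq_nonneg ‖v‖
  linarith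

end OperatorA

/-! ### Transfer between `L²` and the energy space. -/

namespace HamiltonianDensity

variable {n : ℕ} (H : HamiltonianDensity n)

/-- Hellinger–Toeplitz: an everywhere defined symmetric operator on a Hilbert space is bounded. -/
lemma exists_norm_mul_le : ∃ C, 0 ≤ C ∧ ∀ x : X2 n, ‖H.mul x‖ ≤ C * ‖x‖ := by
  have hs : H.mul.IsSymmetric := fun x y => (H.inner_mul_symm x y).symm
  exact ⟨_, norm_nonneg _, (⟨H.mul, hs.continuous⟩ : X2 n →L[ℂ] X2 n).le_opNorm⟩

/-- The pointwise inverse `𝓗⁻¹` of a Hamiltonian density. -/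
def inv : HamiltonianDensity n where
  toFun ζ := (H.toFun ζ)⁻¹
  posDef := by filter_upwards [H.posDef] with ζ h using h.inv
  memLp := H.memLp_inv
  memLp_inv i j := by
    refine (memLp_congr_ae ?_).mp (H.memLp i j)
    filter_upwards [H.posDef] with ζ h
    rw [Matrix.nonsing_inv_nonsing_inv _ ((Matrix.isUnit_iff_isUnit_det _).mp h.isUnit)]

lemma toEuclideanCLM_apply_apply (M N : Matrix (Fin n) (Fin n) ℂ) (v : EuclideanSpace ℂ (Fin n)) :
    Matrix.toEuclideanCLM (𝕜 := ℂ) M (Matrix.toEuclideanCLM (𝕜 := ℂ) N v)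
      = Matrix.toEuclideanCLM (𝕜 := ℂ) (M * N) v := by
  rw [map_mul]; rfl

lemma inv_mul_apply (x : X2 n) : H.inv.mul (H.mul x) = x := by
  apply Lp.ext
  filter_upwards [H.inv.coeFn_mul (H.mul x), H.coeFn_mul x, H.posDef] with ζ h1 h2 h3
  rw [h1, h2, toEuclideanCLM_apply_apply]
  change Matrix.toEuclideanCLM (𝕜 := ℂ) ((H.toFun ζ)⁻¹ * H.toFun ζ) (x ζ) = x ζ
  rw [Matrix.nonsing_inv_mul _ ((Matrix.isUnit_iff_isUnit_det _).mp h3.isUnit), map_one]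
  rfl

lemma mul_inv_apply (x : X2 n) : H.mul (H.inv.mul x) = x := by
  apply Lp.ext
  filter_upwards [H.inv.coeFn_mul x, H.coeFn_mul (H.inv.mul x), H.posDef] with ζ h1 h2 h3
  rw [h2, h1, toEuclideanCLM_apply_apply]
  change Matrix.toEuclideanCLM (𝕜 := ℂ) (H.toFun ζ * (H.toFun ζ)⁻¹) (x ζ) = x ζ
  rw [Matrix.mul_nonsing_inv _ ((Matrix.isUnit_iff_isUnit_det _).mp h3.isUnit), map_one]
  rfl

lemma inner_energy (x y : H.EnergySpace) :
    inner ℂ x y = inner ℂ (H.mul (H.toEnergy.symm x)) (H.toEnergy.symm y) :=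
  H.inner_mul_symm _ _

lemma norm_toEnergy_sq (x : X2 n) : ‖H.toEnergy x‖ ^ 2 = (inner ℂ (H.mul x) x).re := by
  rw [← inner_self_eq_norm_sq (𝕜 := ℂ), inner_energy, LinearEquiv.symm_apply_apply]
  simp only [RCLike.re_eq_complex_re]

/-- This half of the norm equivalence is what carries density from `L²` to the energy space. -/
lemma continuous_toEnergy : Continuous H.toEnergy := by
  obtain ⟨C, hC0, hC⟩ := H.exists_norm_mul_le
  refine AddMonoidHomClass.continuous_of_bound H.toEnergy (√C) fun x => ?_
  refine le_of_sq_le_sq ?_ (by positivity)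
  rw [norm_toEnergy_sq, mul_pow, Real.sq_sqrt hC0]
  refine (Complex.re_le_norm _).trans ((norm_inner_le_norm _ _).trans ?_)
  calc ‖H.mul x‖ * ‖x‖ ≤ C * ‖x‖ * ‖x‖ := by gcongr; exact hC x
    _ = _ := by ring

lemma mem_domain_opAH_iff (A : X2 n →ₗ.[ℂ] X2 n) (x : H.EnergySpace) :
    x ∈ (H.opAH A).domain ↔ H.mul (H.toEnergy.symm x) ∈ A.domain := Iff.rfl

lemma continuous_mul : Continuous H.mul := by
  obtain ⟨C, -, hC⟩ := H.exists_norm_mul_le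
  exact AddMonoidHomClass.continuous_of_bound H.mul C hC

lemma surjective_toEnergy_comp_inv_mul : Function.Surjective (H.toEnergy ∘ H.inv.mul) := by
  refine H.toEnergy.surjective.comp fun x => ⟨H.mul x, H.inv_mul_apply x⟩

/-- The domain of `A𝓗` contains the image of the dense set `D(A)` under `𝓗⁻¹`, which is continuous
and onto the energy space. -/
lemma dense_domain_opAH {A : X2 n →ₗ.[ℂ] X2 n} (hA : Dense (A.domain : Set (X2 n))) :
    Dense ((H.opAH A).domain : Set H.EnergySpace) := by
  have hd := H.surjective_toEnergy_comp_inv_mul.denseRange.dense_image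
    (H.continuous_toEnergy.comp H.inv.continuous_mul) hA
  refine hd.mono ?_
  rintro _ ⟨u, hu, rfl⟩
  rw [SetLike.mem_coe, mem_domain_opAH_iff, Function.comp_apply, LinearEquiv.symm_apply_apply,
    mul_inv_apply]
  exact hu

lemma mem_graph_opAH_iff (A : X2 n →ₗ.[ℂ] X2 n) (x y : H.EnergySpace) :
    (x, y) ∈ (H.opAH A).graph ↔ (H.mul (H.toEnergy.symm x), H.toEnergy.symm y) ∈ A.graph := by
  rw [LinearPMap.mem_graph_iff, LinearPMap.mem_graph_iff]
  constructor
  · rintro ⟨v, rfl, rfl⟩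
    exact ⟨⟨_, v.2⟩, rfl, rfl⟩
  · rintro ⟨⟨v, hv⟩, h, h'⟩
    change v = _ at h
    subst h
    exact ⟨⟨x, hv⟩, rfl, h'⟩

/-- Quasi-dissipativity of `A𝓗` on the energy space implies that of `A` on `L²`. -/
lemma exists_re_inner_le {A : X2 n →ₗ.[ℂ] X2 n}
    (h : GeneratesQuasiContractiveSemigroup (H.opAH A)) :
    ∃ K : ℝ, ∀ u : A.domain, (inner ℂ (u : X2 n) (A u)).re ≤ K * ‖(u : X2 n)‖ ^ 2 := by
  obtain ⟨w, S, -, hS1, hG⟩ := h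
  obtain ⟨C, hC0, hC⟩ := H.inv.exists_norm_mul_le
  -- For `x = 𝓗⁻¹u` the squared energy norm is `⟨u, 𝓗⁻¹u⟩ ≤ C ‖u‖²`, with `C` a bound for `𝓗⁻¹`; the
  -- absolute value allows for negative `w`.
  refine ⟨|w| * C, fun u => ?_⟩
  set x : H.EnergySpace := H.toEnergy (H.inv.mul u) with hx
  have hxu : H.mul (H.toEnergy.symm x) = u := H.mul_inv_apply u
  have hxy : (x, H.toEnergy (A u)) ∈ (H.opAH A).graph := by
    rw [mem_graph_opAH_iff, hxu]
    exact A.mem_graph u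
  have h1 := hG.re_inner_nonpos hS1 (x := x) (y := H.toEnergy (A u) - (w : ℂ) • x) (by
    rw [mem_graph_subScalar_iff, sub_add_cancel]
    exact hxy)
  rw [inner_sub_right, inner_smul_right, Complex.sub_re, Complex.re_ofReal_mul, inner_energy,
    inner_energy, hxu] at h1
  have h2 : |(inner ℂ (u : X2 n) (H.inv.mul u)).re| ≤ C * ‖(u : X2 n)‖ ^ 2 := by
    refine (Complex.abs_re_le_norm _).trans ((norm_inner_le_norm _ _).trans ?_)
    calc ‖(u : X2 n)‖ * ‖H.inv.mul u‖ ≤ ‖(u : X2 n)‖ * (C * ‖(u : X2 n)‖) := by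
          gcongr; exact hC u
      _ = C * ‖(u : X2 n)‖ ^ 2 := by ring
  have h3 : w * (inner ℂ (u : X2 n) (H.inv.mul u)).re ≤ |w| * (C * ‖(u : X2 n)‖ ^ 2) := by
    refine (le_abs_self _).trans ?_
    rw [abs_mul]
    gcongr
  have h4 : (inner ℂ (u : X2 n) (A u)).re - w * (inner ℂ (u : X2 n) (H.inv.mul u)).re ≤ 0 := h1
  linarith

end HamiltonianDensity

end PortHamiltonian

end

theorem corollary1p5 (n : ℕ) (P₁ P₀ : Matrix (Fin n) (Fin n) ℂ)
    (hP₁ : P₁.IsHermitian) (hP₁_inv : IsUnit P₁)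
    (H : PortHamiltonian.HamiltonianDensity n)
    (W : Matrix (Fin n) (Fin n ⊕ Fin n) ℂ)
    (hP₀ : (-((1 / 2 : ℂ) • (P₀ + P₀.conjTranspose))).PosSemidef) :
    PortHamiltonian.GeneratesQuasiContractiveSemigroup
        (H.opAH (PortHamiltonian.opA P₁ P₀ W)) ↔
      PortHamiltonian.GeneratesContractionSemigroup
        (H.opAH (PortHamiltonian.opA P₁ P₀ W)) := by
  constructor
  · intro h
    obtain ⟨K, hK⟩ := H.exists_re_inner_le h
    refine h.generatesContractionSemigroup
      (H.dense_domain_opAH (PortHamiltonian.dense_domainA W)) fun x y hxy => ?_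
    rw [H.mem_graph_opAH_iff, LinearPMap.mem_graph_iff] at hxy
    obtain ⟨u, hu, hy⟩ := hxy
    simp only at hu hy
    -- The energy product of `x` and `A𝓗x` becomes the `L²` product of `u = 𝓗x` and `Au`.
    rw [H.inner_energy, ← hu, ← hy]
    exact PortHamiltonian.re_inner_opA_nonpos hP₁ hP₀ hK u
  · intro h
    exact ⟨0, by rwa [PortHamiltonian.subScalar_zero]⟩
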